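/- A \emph{2-precubical set} $C$ consists of sets $C(0),C(1),C(2)$ (vertices, edges, squares) and face maps $\partial^{\epsilon}:C(1)\to C(0)$, $\partial_i^{\epsilon}:C(2)\to C(1)$ ($i\in\{0,1\}$, $\epsilon\in\{-,+\}$) with $\partial^{\epsilon}\partial_0^{\epsilon'}=\partial^{\epsilon'}\partial_1^{\epsilon}$. An edge $a$ goes from $\partial^-(a)$ to $\partial^+(a)$. For edges $a,b,a',b'$ write $a\cdot b\sim b'\cdot a'$ if there is a square $\alpha$ with $a=\partial_0^-\alpha$, $b=\partial_1^+\alpha$, $b'=\partial_1^-\alpha$, $a'=\partial_0^+\alpha$, or a square with this property after exchanging the two sides $a\cdot b$ and $b'\cdot a'$. Suppose that $C$ satisfies the following conditions. (1) (At most one square closing.) If $a_1\cdot b_1\sim b_1'\cdot a_1'$ and $a_2\cdot b_2\sim b_2'\cdot a_2'$, and if $(a_1,b_1)=(a_2,b_2)$, or $(b_1',a_1')=(b_2',a_2')$, or $(a_1,b_1')=(a_2,b_2')$, or $(b_1,a_1')=(b_2,a_2')$, then $a_1=a_2$, $b_1=b_2$, $a_1'=a_2'$ and $b_1'=b_2'$.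 (2) (Cube property.) Denote the faces of the standard 3-cube by words of length 3 over $\{-,0,+\}$ (edges have one letter $0$, squares have two), and say that a family of edges of $C$, indexed by edges of the standard 3-cube, fills the square face with letters $0$ in positions $i<j$ and $s$ in the remaining position if $a\cdot b\sim b'\cdot a'$ holds, where $a,a'$ are the edges obtained by replacing the letter in position $j$ by $-$, $+$ respectively, and $b',b$ those obtained by replacing the letter in position $i$ by $-$, $+$ respectively. Then for every $u\in\{-,+\}^3$, every family of edges of $C$ indexed by the nine edges of the standard 3-cube having a letter in common with $u$ (in the same position) that fills the three square faces containing the vertex $u$ extends to a family indexed by all twelve edges that fills all six square faces. (3) Whenever $a\cdot b\sim b'\cdot a'$, one has $a=b'$ if and only if $b=a'$ (that is, for every square $\bar x\cdot x'\sim y\cdot\bar y'$ one has $x=x'$ if and only if $y=y'$). A \emph{dipath} is a path in the directed graph $(C(0),C(1))$; a \emph{path} may also go through edges $a$ backwards, as reversed edges $\bar a$. Extend $\sim$ to the smallest symmetric relation on paths of length 2 such that $a\cdot b\sim b'\cdot a'$, $\bar b\cdot\bar a\sim\bar a'\cdot\bar b'$, $\bar a\cdot b'\sim b\cdot\bar a'$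 and $\bar b'\cdot a\sim a'\cdot\bar b$ whenever $a\cdot b\sim b'\cdot a'$ for edges $a,b,a',b'$ of $C$. \emph{Dihomotopy} is the smallest congruence with respect to concatenation (on paths with the same endpoints) containing $\sim$, and \emph{homotopy} is the smallest congruence containing dihomotopy such that, for every edge $a:x\to y$, $a\cdot\bar a$ is homotopic to the empty path at $x$ and $\bar a\cdot a$ is homotopic to the empty path at $y$. \textbf{Theorem.} Two dipaths of $C$ with the same source and the same target are homotopic if and only if they are dihomotopic. -/

import Mathlib

universe u v w

/-- A 2-precubical set: vertices, edges and squares with their faces. The sign `-` is `false` and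
the sign `+` is `true`; `edgeFace ε` is `∂^ε_{0,0}` and `squareFace i ε` is `∂^ε_{i,1}`. -/
structure TwoPrecubicalSet where
  Vertex : Type u
  Edge : Type v
  Square : Type w
  edgeFace : Bool → Edge → Vertex
  squareFace : Fin 2 → Bool → Square → Edge
  face_face : ∀ (ε ε' : Bool) (α : Square),
    edgeFace ε (squareFace 0 ε' α) = edgeFace ε' (squareFace 1 ε α)

namespace TwoPrecubicalSet

variable (C : TwoPrecubicalSet.{u, v, w})

/-- The underlying directed graph. A dipath from `x` to `y` is a `Quiver.Path x y`. -/
instance : Quiver C.Vertex where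
  Hom x y := {a : C.Edge // C.edgeFace false a = x ∧ C.edgeFace true a = y}

/-- The underlying non-directed graph: its arrows are the edges and the reversed edges of `C`,
so that a `Quiver.Path` in it is a non-directed path in `C`. -/
abbrev UVertex : Type u := Quiver.Symmetrify C.Vertex

/-- `C.Tile a b b' a'`: the set `C` contains a square with boundary `a · b ∼ b' · a'`, that is
a square `α` with `a = ∂₀⁻ α`, `b = ∂₁⁺ α`, `b' = ∂₁⁻ α`, `a' = ∂₀⁺ α`, or symmetrically (with
the two sides `a · b` and `b' · a'` exchanged):

```
        x₁₁
     b ↗   ↖ a'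
    x₁₀     x₀₁
     a ↖   ↗ b'
        x₀₀
```
-/
def Tile (a b b' a' : C.Edge) : Prop :=
  ∃ α : C.Square,
    (a = C.squareFace 0 false α ∧ b = C.squareFace 1 true α ∧
      b' = C.squareFace 1 false α ∧ a' = C.squareFace 0 true α) ∨
    (b' = C.squareFace 0 false α ∧ a' = C.squareFace 1 true α ∧
      a = C.squareFace 1 false α ∧ b = C.squareFace 0 true α)

/-- The at most one square closing property: a pair of edges sitting in a square in one of the
four positions below (left side, right side, bottom, top) determines the two other edges
of the square. As with `Tile`, which of the two directions of a square comes first is irrelevant.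
Several squares with the same boundary are allowed. -/
structure AtMostOneSquareClosing : Prop where
  left : ∀ a b b₁ a₁ b₂ a₂, C.Tile a b b₁ a₁ → C.Tile a b b₂ a₂ → b₁ = b₂ ∧ a₁ = a₂
  right : ∀ b' a' a₁ b₁ a₂ b₂, C.Tile a₁ b₁ b' a' → C.Tile a₂ b₂ b' a' → a₁ = a₂ ∧ b₁ = b₂
  bottom : ∀ a b' b₁ a₁ b₂ a₂, C.Tile a b₁ b' a₁ → C.Tile a b₂ b' a₂ → b₁ = b₂ ∧ a₁ = a₂
  top : ∀ b a' a₁ b₁ a₂ b₂, C.Tile a₁ b b₁ a' → C.Tile a₂ b b₂ a' → a₁ = a₂ ∧ b₁ = b₂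

/-- The three families of parallel edges of a cube in `C`. With the faces of the standard 3-cube
written as words over `-`, `0`, `+`, the edge `0st` is `e₀ s t`, the edge `s0t` is `e₁ s t` and
the edge `st0` is `e₂ s t`. -/
structure CubeEdges where
  e₀ : Bool → Bool → C.Edge
  e₁ : Bool → Bool → C.Edge
  e₂ : Bool → Bool → C.Edge

namespace CubeEdges

variable {C}

/-- The face `00s` of the cube is filled by a square. -/
def Face₂ (e : C.CubeEdges) (s : Bool) : Prop :=
  C.Tile (e.e₀ false s) (e.e₁ true s) (e.e₁ false s) (e.e₀ true s)

/-- The face `0s0` of the cube is filled by a square. -/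
def Face₁ (e : C.CubeEdges) (s : Bool) : Prop :=
  C.Tile (e.e₀ s false) (e.e₂ true s) (e.e₂ false s) (e.e₀ s true)

/-- The face `s00` of the cube is filled by a square. -/
def Face₀ (e : C.CubeEdges) (s : Bool) : Prop :=
  C.Tile (e.e₁ s false) (e.e₂ s true) (e.e₂ s false) (e.e₁ s true)

/-- The edges in the faces that contain the vertex `u₀u₁u₂` form a half cube in `C`: these three
faces are filled. Nothing is said about the three edges lying in none of these faces. -/
def IsHalfCube (e : C.CubeEdges) (u₀ u₁ u₂ : Bool) : Prop :=
  e.Face₀ u₀ ∧ e.Face₁ u₁ ∧ e.Face₂ u₂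

/-- The edges form a hollow cube in `C`: the six faces are filled. -/
def IsHollowCube (e : C.CubeEdges) : Prop :=
  ∀ s : Bool, e.Face₀ s ∧ e.Face₁ s ∧ e.Face₂ s

/-- `e` and `e'` agree on the nine edges that have a letter in common with `u₀u₁u₂`, which are
those of the half cube at the vertex `u₀u₁u₂`. -/
def AgreeOnHalfCube (e e' : C.CubeEdges) (u₀ u₁ u₂ : Bool) : Prop :=
  (∀ s t, s = u₁ ∨ t = u₂ → e.e₀ s t = e'.e₀ s t) ∧
  (∀ s t, s = u₀ ∨ t = u₂ → e.e₁ s t = e'.e₁ s t) ∧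
  (∀ s t, s = u₀ ∨ t = u₁ → e.e₂ s t = e'.e₂ s t)

end CubeEdges

/-- The cube property: every half cube in `C` extends to a hollow cube. A half cube is what remains
of the hollow 3-cube once the cubes containing a given vertex are removed; here `u₀u₁u₂` is the
opposite vertex. As with `Tile`, the order of the two directions of each square is irrelevant. -/
def CubeProperty : Prop :=
  ∀ (u₀ u₁ u₂ : Bool) (e : C.CubeEdges), e.IsHalfCube u₀ u₁ u₂ →
    ∃ e' : C.CubeEdges, e'.IsHollowCube ∧ e.AgreeOnHalfCube e' u₀ u₁ u₂

/-- In every square, the two edges at the bottom (coinitial) are equal if and only if the two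
edges at the top (cofinal) are. -/
def BottomEqIffTopEq : Prop :=
  ∀ a b b' a', C.Tile a b b' a' → (a = b' ↔ b = a')

variable {C}

/-- The non-directed path of length one consisting of an edge. -/
def pos {x y : C.Vertex} (a : x ⟶ y) : Quiver.Path (V := C.UVertex) x y :=
  (Quiver.Hom.toPos a).toPath

/-- The non-directed path of length one consisting of a reversed edge. -/
def neg {x y : C.Vertex} (a : x ⟶ y) : Quiver.Path (V := C.UVertex) y x :=
  (Quiver.Hom.toNeg a).toPath

/-- The non-directed path underlying a dipath. -/
def toUPath {x y : C.Vertex} (f : Quiver.Path x y) : Quiver.Path (V := C.UVertex) x y :=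
  Quiver.Symmetrify.of.mapPath f

/-- The symmetric relation `∼` on non-directed paths of length two. -/
inductive PathTile : ∀ {x y : C.UVertex}, Quiver.Path x y → Quiver.Path x y → Prop
  | pos_pos {x₀₀ x₁₀ x₀₁ x₁₁ : C.Vertex}
      (a : x₀₀ ⟶ x₁₀) (b : x₁₀ ⟶ x₁₁) (b' : x₀₀ ⟶ x₀₁) (a' : x₀₁ ⟶ x₁₁) :
      C.Tile a.1 b.1 b'.1 a'.1 →
      PathTile ((pos a).comp (pos b)) ((pos b').comp (pos a'))
  | neg_neg {x₀₀ x₁₀ x₀₁ x₁₁ : C.Vertex}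
      (a : x₀₀ ⟶ x₁₀) (b : x₁₀ ⟶ x₁₁) (b' : x₀₀ ⟶ x₀₁) (a' : x₀₁ ⟶ x₁₁) :
      C.Tile a.1 b.1 b'.1 a'.1 →
      PathTile ((neg b).comp (neg a)) ((neg a').comp (neg b'))
  | neg_pos {x₀₀ x₁₀ x₀₁ x₁₁ : C.Vertex}
      (a : x₀₀ ⟶ x₁₀) (b : x₁₀ ⟶ x₁₁) (b' : x₀₀ ⟶ x₀₁) (a' : x₀₁ ⟶ x₁₁) :
      C.Tile a.1 b.1 b'.1 a'.1 →
      PathTile ((neg a).comp (pos b')) ((pos b).comp (neg a'))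
  | neg_pos' {x₀₀ x₁₀ x₀₁ x₁₁ : C.Vertex}
      (a : x₀₀ ⟶ x₁₀) (b : x₁₀ ⟶ x₁₁) (b' : x₀₀ ⟶ x₀₁) (a' : x₀₁ ⟶ x₁₁) :
      C.Tile a.1 b.1 b'.1 a'.1 →
      PathTile ((neg b').comp (pos a)) ((pos a').comp (neg b))
  | symm {x y : C.UVertex} {p q : Quiver.Path x y} : PathTile p q → PathTile q p

/-- Dihomotopy: the smallest congruence (with respect to concatenation) on non-directed paths
containing `∼`. -/
inductive Dihomotopic : ∀ {x y : C.UVertex}, Quiver.Path x y → Quiver.Path x y → Prop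
  | tile {x y : C.UVertex} {p q : Quiver.Path x y} : PathTile p q → Dihomotopic p q
  | refl {x y : C.UVertex} (p : Quiver.Path x y) : Dihomotopic p p
  | symm {x y : C.UVertex} {p q : Quiver.Path x y} : Dihomotopic p q → Dihomotopic q p
  | trans {x y : C.UVertex} {p q r : Quiver.Path x y} :
      Dihomotopic p q → Dihomotopic q r → Dihomotopic p r
  | comp {x y z : C.UVertex} {p p' : Quiver.Path x y} {q q' : Quiver.Path y z} :
      Dihomotopic p p' → Dihomotopic q q' → Dihomotopic (p.comp q) (p'.comp q')

/-- Homotopy: the smallest congruence on non-directed paths containing dihomotopy and making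
every edge and its reverse cancel. -/
inductive Homotopic : ∀ {x y : C.UVertex}, Quiver.Path x y → Quiver.Path x y → Prop
  | dihom {x y : C.UVertex} {p q : Quiver.Path x y} : Dihomotopic p q → Homotopic p q
  | pos_neg {x y : C.Vertex} (a : x ⟶ y) : Homotopic ((pos a).comp (neg a)) Quiver.Path.nil
  | neg_pos {x y : C.Vertex} (a : x ⟶ y) : Homotopic ((neg a).comp (pos a)) Quiver.Path.nil
  | symm {x y : C.UVertex} {p q : Quiver.Path x y} : Homotopic p q → Homotopic q p
  | trans {x y : C.UVertex} {p q r : Quiver.Path x y} :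
      Homotopic p q → Homotopic q r → Homotopic p r
  | comp {x y z : C.UVertex} {p p' : Quiver.Path x y} {q q' : Quiver.Path y z} :
      Homotopic p p' → Homotopic q q' → Homotopic (p.comp q) (p'.comp q')

end TwoPrecubicalSet

/-!
Forget the vertices and look at words in the signed edges of `C`. The squares of `C` become
partially defined swaps `x · y ↔ y' · x'` of two consecutive letters, in every orientation of the
square, and homotopy adds the cancellations `x · x⁻¹ ↔ 1`. The three hypotheses on `C` say that
a swap is determined by either pair of adjacent sides of its square, that swaps satisfy a braid
relation (if one side of it is defined, then so is the other one, with the same result), and that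
swaps preserve cancelling pairs. These are the axioms of `SwapSystem`.

Call words *equivalent* when they are related by swaps. The braid relation gives
`SwapSystem.Eqv.lastRel`: if `q · a` and `q' · b` are equivalent, then either `a = b` and `q`, `q'`
are equivalent, or a single swap `c · a ↔ d · b` accounts for the change of the last letter.
Call a word *reduced* if no equivalent word contains a cancelling pair. By the previous fact, letters
act on equivalence classes of reduced words: `x` removes a final `x⁻¹` if an equivalent word has
one, and is appended otherwise (`SwapSystem.act`). The letters `x` and `x⁻¹` act as inverse
bijections, and the two sides of a swap act in the same way (`SwapSystem.act_swap`), so that the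
action of a path depends only on its homotopy class. Acting on the empty word, a reduced word gives
back itself. Swaps preserve signs, so the word of a dipath is reduced, and the words of two homotopic
dipaths are therefore equivalent. All intermediate words are positive, so they are words of
dipaths again, and the equivalence is a dihomotopy.
-/

/-! ### Swap systems and equivalence of words -/

/-- An alphabet with formal inverses and partially defined swaps of two consecutive letters:
`swap x y y' x'` means that `x · y` can be replaced by `y' · x'`. -/
structure SwapSystem (S : Type*) where
  inv : S → S
  swap : S → S → S → S → Prop
  inv_inv : ∀ x, inv (inv x) = x
  symm : ∀ {x y y' x'}, swap x y y' x' → swap y' x' x y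
  /-- The same square, read from the end of `x`. -/
  rotate : ∀ {x y y' x'}, swap x y y' x' → swap (inv x) y' y (inv x')
  unique : ∀ {x y y₁ x₁ y₂ x₂}, swap x y y₁ x₁ → swap x y y₂ x₂ → y₁ = y₂ ∧ x₁ = x₂
  cancel : ∀ {x y' x'}, swap x (inv x) y' x' → x' = inv y'
  /-- If the letters of `x · y · z` can be swapped in positions 2, 1, 2, then they can be swapped
  in positions 1, 2, 1, with the same result. -/
  braid : ∀ {x y z z₁ y₁ z₂ x₁ y₂ x₂}, swap y z z₁ y₁ → swap x z₁ z₂ x₁ → swap x₁ y₁ y₂ x₂ →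
    ∃ y' x' z', swap x y y' x' ∧ swap x' z z' x₂ ∧ swap y' z' z₂ y₂

namespace SwapSystem

variable {S : Type*} (D : SwapSystem S)

theorem rotate' {x y y' x' : S} (h : D.swap x y y' x') : D.swap (D.inv y') x x' (D.inv y) :=
  D.rotate (D.symm h)

theorem unique_end {x₁ x₂ y y₁ y₂ x' : S} (h₁ : D.swap x₁ y y₁ x') (h₂ : D.swap x₂ y y₂ x') :
    x₁ = x₂ ∧ y₁ = y₂ := by
  obtain ⟨h, h'⟩ := D.unique (D.symm (D.rotate' h₁)) (D.symm (D.rotate' h₂))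
  exact ⟨h', by rw [← D.inv_inv y₁, h, D.inv_inv]⟩

/-- A single swap in a word. Words are written from right to left: the head of the list is the last
letter. -/
inductive Step : List S → List S → Prop
  | swap {x y y' x' : S} (q : List S) : D.swap x y y' x' → Step (y :: x :: q) (x' :: y' :: q)
  | cons (a : S) {q q' : List S} : Step q q' → Step (a :: q) (a :: q')

/-- Two words are equivalent if they are related by a sequence of swaps. -/
def Eqv : List S → List S → Prop := Relation.ReflTransGen D.Step

variable {D}

theorem Step.symm {w w' : List S} (h : D.Step w w') : D.Step w' w := by
  induction h with
  | swap q h => exact .swap q (D.symm h)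
  | cons a _ ih => exact .cons a ih

theorem Step.length_eq {w w' : List S} (h : D.Step w w') : w.length = w'.length := by
  induction h with
  | swap q h => rfl
  | cons a _ ih => simp [ih]

namespace Eqv

theorem refl (w : List S) : D.Eqv w w := Relation.ReflTransGen.refl

theorem trans {w w' w'' : List S} (h : D.Eqv w w') (h' : D.Eqv w' w'') : D.Eqv w w'' :=
  Relation.ReflTransGen.trans h h'

theorem symm {w w' : List S} (h : D.Eqv w w') : D.Eqv w' w := by
  induction h with
  | refl => exact refl w
  | tail _ h ih => exact (Relation.ReflTransGen.single h.symm).trans ih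

theorem cons (a : S) {q q' : List S} (h : D.Eqv q q') : D.Eqv (a :: q) (a :: q') :=
  Relation.ReflTransGen.lift (a :: ·) (fun _ _ => Step.cons a) _ _ h

theorem swap {x y y' x' : S} (h : D.swap x y y' x') (q : List S) :
    D.Eqv (y :: x :: q) (x' :: y' :: q) :=
  Relation.ReflTransGen.single (.swap q h)

theorem length_eq {w w' : List S} (h : D.Eqv w w') : w.length = w'.length := by
  induction h with
  | refl => rfl
  | tail _ h ih => exact ih.trans h.length_eq

end Eqv

variable (D) in
/-- How the last letters of two equivalent words are related: they agree, or a single swap, preceded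
and followed by equivalences not involving the last letter, exchanges them. -/
inductive LastRel : List S → List S → Prop
  | nil : LastRel [] []
  | same (a : S) {q q' : List S} : D.Eqv q q' → LastRel (a :: q) (a :: q')
  | swap {a b c d : S} {q q' r : List S} : D.Eqv q (c :: r) → D.Eqv q' (d :: r) →
      D.swap c a d b → LastRel (a :: q) (b :: q')

theorem LastRel.of_step {w w' : List S} : D.Step w w' → D.LastRel w w'
  | .swap q h => .swap (.refl _) (.refl _) h
  | .cons a h => .same a (Relation.ReflTransGen.single h)

/-- `LastRel` is transitive on words for which equivalence implies `LastRel` in smaller length: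
two successive swaps of the last letter either involve the same square, and undo each other, or
can be braided into a single one. -/
theorem LastRel.trans {w w' w'' : List S}
    (ih : ∀ u u' : List S, u.length < w.length → D.Eqv u u' → D.LastRel u u')
    (h : D.LastRel w w') (h' : D.LastRel w' w'') : D.LastRel w w'' := by
  cases h with
  | nil => exact h'
  | same a h =>
    cases h' with
    | same _ h' => exact .same a (h.trans h')
    | swap h₁ h₂ h₃ => exact .swap (h.trans h₁) h₂ h₃
  | @swap a b c d q q' r h₁ h₂ h₃ =>
    cases h' with
    | same _ h' => exact .swap h₁ (h'.symm.trans h₂) h₃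
    | @swap _ e d' f _ q'' r' h₄ h₅ h₆ =>
      have hlen : (d :: r).length < (a :: q).length := by
        have := h₁.length_eq
        simp only [List.length_cons] at this ⊢
        omega
      cases ih _ _ hlen (h₂.symm.trans h₄) with
      | same _ h =>
        obtain ⟨rfl, rfl⟩ := D.unique (D.symm h₃) h₆
        exact .same _ ((h₁.trans (h.cons c)).trans h₅.symm)
      | swap h₇ h₈ h₉ =>
        obtain ⟨i, j, k, hi, hj, hk⟩ := D.braid h₃ h₉ h₆
        exact .swap ((h₁.trans (h₇.cons c)).trans (.swap hi _))
          ((h₅.trans (h₈.cons f)).trans (.swap (D.symm hk) _)) hj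

/-- Equivalent words satisfy `LastRel`. -/
theorem Eqv.lastRel {w w' : List S} (h : D.Eqv w w') : D.LastRel w w' := by
  induction hn : w.length using Nat.strong_induction_on generalizing w w' with
  | _ n ih =>
    subst hn
    induction h with
    | refl =>
      cases w with
      | nil => exact .nil
      | cons a q => exact .same a (.refl q)
    | tail _ h₂ ih' =>
      exact ih'.trans (fun u u' hu huu' => ih _ hu huu' rfl) (.of_step h₂)

theorem Eqv.cases_cons {a b : S} {q q' : List S} (h : D.Eqv (a :: q) (b :: q')) :
    (a = b ∧ D.Eqv q q') ∨
      ∃ c d r, D.Eqv q (c :: r) ∧ D.Eqv q' (d :: r) ∧ D.swap c a d b := by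
  cases h.lastRel with
  | same _ h => exact .inl ⟨rfl, h⟩
  | swap h₁ h₂ h₃ => exact .inr ⟨_, _, _, h₁, h₂, h₃⟩

theorem Eqv.of_cons {a : S} {q q' : List S} (h : D.Eqv (a :: q) (a :: q')) : D.Eqv q q' := by
  rcases h.cases_cons with ⟨-, h⟩ | ⟨c, d, r, h₁, h₂, h₃⟩
  · exact h
  · obtain ⟨rfl, -⟩ := D.unique_end h₃ (D.symm h₃)
    exact h₁.trans h₂.symm

/-! ### Reduced words -/

variable (D) in
/-- A word is reduced if no equivalent word contains a cancelling pair. -/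
def Reduced (w : List S) : Prop :=
  ∀ (c : S) (u v : List S), ¬ D.Eqv w (v ++ D.inv c :: c :: u)

theorem Reduced.congr {w w' : List S} (hw : D.Reduced w) (h : D.Eqv w w') : D.Reduced w' :=
  fun c u v h' => hw c u v (h.trans h')

theorem Reduced.of_cons {a : S} {q : List S} (h : D.Reduced (a :: q)) : D.Reduced q :=
  fun c u v h' => h c u (a :: v) (h'.cons a)

theorem Reduced.not_cancel {p u : List S} {c : S} (hp : D.Reduced p) :
    ¬ D.Eqv p (D.inv c :: c :: u) :=
  hp c u []

/-- Appending a letter to a reduced word creates a cancellation only if the word ends, up to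
equivalence, with the inverse letter. -/
theorem Reduced.cons {a : S} {p : List S} (hp : D.Reduced p)
    (ha : ∀ q, ¬ D.Eqv p (D.inv a :: q)) : D.Reduced (a :: p) := by
  induction hn : p.length using Nat.strong_induction_on generalizing a p with
  | _ n ih =>
    subst hn
    intro c u v h
    cases v with
    | nil =>
      rcases h.cases_cons with ⟨rfl, h⟩ | ⟨e, f, r, h₁, h₂, h₃⟩
      · exact ha u (by rwa [D.inv_inv])
      rcases h₂.cases_cons with ⟨rfl, -⟩ | ⟨g, k, t, -, h₄, h₅⟩
      · -- the pair `c · c⁻¹` is swapped with `e · a`, so `e · a` is a cancelling pair as well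
        have := D.cancel (D.symm h₃)
        rw [this, D.inv_inv] at ha
        exact ha r h₁
      · -- both squares have the sides `c` and `f` with a common end, so they are the same
        have h₆ := D.symm (D.rotate' (D.symm h₃))
        rw [D.inv_inv] at h₆
        obtain ⟨-, rfl⟩ := D.unique_end h₅ h₆
        apply hp.not_cancel (c := D.inv e) (u := t)
        rw [D.inv_inv]
        exact h₁.trans (h₄.cons e)
    | cons b v =>
      rcases h.cases_cons with ⟨-, h⟩ | ⟨e, f, r, h₁, h₂, h₃⟩
      · exact hp c u v h
      have hr : D.Reduced r := (hp.congr h₁).of_cons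
      have hlen : r.length < p.length := by rw [h₁.length_eq]; simp
      by_cases hf : ∃ q, D.Eqv r (D.inv f :: q)
      · obtain ⟨s, hs⟩ := hf
        have h₄ := D.rotate (D.symm h₃)
        exact ha _ ((h₁.trans (hs.cons e)).trans (.swap h₄ s))
      · exact ih _ hlen hr (fun q hq => hf ⟨q, hq⟩) rfl c u v h₂.symm

/-! ### The action of letters on reduced words -/

variable (D) in
open Classical in
/-- The action of a letter on words, well defined up to equivalence: a final letter `a⁻¹` of an
equivalent word is removed if there is one, and `a` is appended otherwise. -/
noncomputable def act (a : S) (p : List S) : List S :=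
  if h : ∃ q, D.Eqv p (D.inv a :: q) then h.choose else a :: p

theorem act_of_eqv {a : S} {p q : List S} (h : D.Eqv p (D.inv a :: q)) :
    D.Eqv (D.act a p) q := by
  have h' : ∃ q, D.Eqv p (D.inv a :: q) := ⟨q, h⟩
  rw [act, dif_pos h']
  exact (h'.choose_spec.symm.trans h).of_cons

theorem act_of_not {a : S} {p : List S} (h : ∀ q, ¬ D.Eqv p (D.inv a :: q)) :
    D.act a p = a :: p :=
  dif_neg fun ⟨q, hq⟩ => h q hq

theorem act_congr (a : S) {p p' : List S} (h : D.Eqv p p') :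
    D.Eqv (D.act a p) (D.act a p') := by
  by_cases hp : ∃ q, D.Eqv p (D.inv a :: q)
  · obtain ⟨q, hq⟩ := hp
    exact (act_of_eqv hq).trans (act_of_eqv (h.symm.trans hq)).symm
  · rw [act_of_not fun q hq => hp ⟨q, hq⟩, act_of_not fun q hq => hp ⟨q, h.trans hq⟩]
    exact h.cons a

theorem Reduced.act (a : S) {p : List S} (hp : D.Reduced p) : D.Reduced (D.act a p) := by
  by_cases h : ∃ q, D.Eqv p (D.inv a :: q)
  · obtain ⟨q, hq⟩ := h
    exact (hp.congr hq).of_cons.congr (act_of_eqv hq).symm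
  · rw [act_of_not fun q hq => h ⟨q, hq⟩]
    exact hp.cons fun q hq => h ⟨q, hq⟩

theorem act_inv_act (a : S) {p : List S} (hp : D.Reduced p) :
    D.Eqv (D.act (D.inv a) (D.act a p)) p := by
  by_cases h : ∃ q, D.Eqv p (D.inv a :: q)
  · obtain ⟨q, hq⟩ := h
    refine (act_congr _ (act_of_eqv hq)).trans ?_
    rw [act_of_not]
    · exact hq.symm
    · intro r hr
      rw [D.inv_inv] at hr
      exact hp.not_cancel (hq.trans (hr.cons _))
  · rw [act_of_not fun q hq => h ⟨q, hq⟩]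
    exact act_of_eqv (by rw [D.inv_inv]; exact .refl _)

/-- The case of `act_swap` in which the first letter of one side is cancelled. -/
theorem act_swap_of_eqv {a b b' a' : S} (h : D.swap a b b' a') {p q : List S}
    (hq : D.Eqv p (D.inv a :: q)) :
    D.Eqv (D.act b (D.act a p)) (D.act a' (D.act b' p)) := by
  have hinv : D.swap (D.inv b) (D.inv a) (D.inv a') (D.inv b') := D.rotate (D.symm (D.rotate h))
  by_cases hb : ∃ r, D.Eqv q (D.inv b :: r)
  · obtain ⟨r, hr⟩ := hb
    have h₁ : D.Eqv p (D.inv b' :: D.inv a' :: r) := (hq.trans (hr.cons _)).trans (.swap hinv r)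
    exact ((act_congr b (act_of_eqv hq)).trans (act_of_eqv hr)).trans
      ((act_congr a' (act_of_eqv h₁)).trans (act_of_eqv (.refl _))).symm
  replace hb : ∀ r, ¬ D.Eqv q (D.inv b :: r) := fun r hr => hb ⟨r, hr⟩
  by_cases hb' : ∃ s, D.Eqv p (D.inv b' :: s)
  · obtain ⟨s, hs⟩ := hb'
    rcases (hq.symm.trans hs).cases_cons with ⟨hab, -⟩ | ⟨k, l, t, h₁, -, h₂⟩
    · have hab' : b' = a := by rw [← D.inv_inv b', ← hab, D.inv_inv]
      subst hab'
      -- the square has the sides `a` and `a` with a common origin, hence also `b = a'`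
      have h₃ := D.rotate h
      have h₄ : D.inv a' = D.inv b := D.cancel (x := D.inv b') (by rwa [D.inv_inv])
      have h₅ : a' = b := by rw [← D.inv_inv a', h₄, D.inv_inv]
      subst h₅
      exact .refl _
    · obtain ⟨rfl, -⟩ := D.unique_end h₂ hinv
      exact absurd h₁ (hb t)
  replace hb' : ∀ s, ¬ D.Eqv p (D.inv b' :: s) := fun s hs => hb' ⟨s, hs⟩
  refine (act_congr b (act_of_eqv hq)).trans ?_
  rw [act_of_not hb, act_of_not hb']
  exact (act_of_eqv ((hq.cons b').trans (.swap (D.rotate h) q))).symm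

/-- After the first letter `a` of a side `a · b` of a swap is appended, `b` cancels nothing, unless
`a` and `b` are inverse to each other or the other side starts with a cancellation. -/
theorem not_eqv_cons_of_swap {a b b' a' : S} (h : D.swap a b b' a') {p : List S}
    (hb' : ∀ q, ¬ D.Eqv p (D.inv b' :: q)) (hab : b ≠ D.inv a) (r : List S) :
    ¬ D.Eqv (a :: p) (D.inv b :: r) := by
  intro hr
  rcases hr.cases_cons with ⟨hab', -⟩ | ⟨k, l, t, h₁, -, h₂⟩
  · exact hab (by rw [hab', D.inv_inv])
  · obtain ⟨rfl, -⟩ := D.unique_end h₂ (D.rotate' h)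
    exact hb' t h₁

/-- The two sides of a swap act in the same way. -/
theorem act_swap {a b b' a' : S} (h : D.swap a b b' a') {p : List S} (hp : D.Reduced p) :
    D.Eqv (D.act b (D.act a p)) (D.act a' (D.act b' p)) := by
  by_cases ha : ∃ q, D.Eqv p (D.inv a :: q)
  · obtain ⟨q, hq⟩ := ha
    exact act_swap_of_eqv h hq
  by_cases hb' : ∃ q, D.Eqv p (D.inv b' :: q)
  · obtain ⟨q, hq⟩ := hb'
    exact (act_swap_of_eqv (D.symm h) hq).symm
  replace ha : ∀ q, ¬ D.Eqv p (D.inv a :: q) := fun q hq => ha ⟨q, hq⟩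
  replace hb' : ∀ q, ¬ D.Eqv p (D.inv b' :: q) := fun q hq => hb' ⟨q, hq⟩
  by_cases hab : b = D.inv a
  · subst hab
    obtain rfl := D.cancel h
    exact (act_inv_act a hp).trans (act_inv_act b' hp).symm
  have hab' : a' ≠ D.inv b' := by
    rintro rfl
    exact hab (D.cancel (D.symm h))
  rw [act_of_not ha, act_of_not hb', act_of_not (not_eqv_cons_of_swap h hb' hab),
    act_of_not (not_eqv_cons_of_swap (D.symm h) ha hab')]
  exact .swap h p

variable (D) in
/-- The action of a word: its letters act successively, the head of the list last. -/
noncomputable def actWord (w p : List S) : List S := w.foldr D.act p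

theorem actWord_append (w w' p : List S) :
    D.actWord (w ++ w') p = D.actWord w (D.actWord w' p) :=
  List.foldr_append

theorem actWord_congr (w : List S) {p p' : List S} (h : D.Eqv p p') :
    D.Eqv (D.actWord w p) (D.actWord w p') := by
  induction w with
  | nil => exact h
  | cons a w ih => exact act_congr a ih

theorem Reduced.actWord (w : List S) {p : List S} (hp : D.Reduced p) :
    D.Reduced (D.actWord w p) := by
  induction w with
  | nil => exact hp
  | cons a w ih => exact ih.act a

theorem Reduced.actWord_nil {w : List S} (hw : D.Reduced w) : D.Eqv (D.actWord w []) w := by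
  induction w with
  | nil => exact .refl _
  | cons a w ih =>
    refine (act_congr a (ih hw.of_cons)).trans ?_
    rw [act_of_not]
    · exact .refl _
    · intro q hq
      exact hw.not_cancel (c := D.inv a) (u := q) (by simpa only [D.inv_inv] using hq.cons a)

end SwapSystem

/-! ### The swap system of signed edges -/

namespace TwoPrecubicalSet

variable {C : TwoPrecubicalSet.{u, v, w}}

theorem Tile.symm {a b b' a' : C.Edge} (h : C.Tile a b b' a') : C.Tile b' a' a b := by
  obtain ⟨α, h⟩ := h
  exact ⟨α, by tauto⟩

variable (C) in
/-- The swaps of signed edges given by the squares of `C`; the letter `(a, true)` is the edge `a`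
and `(a, false)` is the reversed edge. The conditionals recover the square from the two sides
`x · y` and `y' · x'` of its boundary: if `y` is a reversed edge, then `x'` is the lower one of the
parallel edges `x` and `x'`, and similarly for `y` and `y'`. -/
def SignedTile (x y y' x' : C.Edge × Bool) : Prop :=
  x'.2 = x.2 ∧ y'.2 = y.2 ∧
    C.Tile (bif y.2 then x.1 else x'.1) (bif x.2 then y.1 else y'.1)
      (bif x.2 then y'.1 else y.1) (bif y.2 then x'.1 else x.1)

theorem SignedTile.symm {x y y' x' : C.Edge × Bool} (h : C.SignedTile x y y' x') :
    C.SignedTile y' x' x y := by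
  obtain ⟨x, s⟩ := x
  obtain ⟨y, t⟩ := y
  obtain ⟨x', s'⟩ := x'
  obtain ⟨y', t'⟩ := y'
  obtain ⟨h₁, h₂, h⟩ := h
  dsimp only at h₁ h₂ h
  subst h₁ h₂
  refine ⟨rfl, rfl, ?_⟩
  cases s' <;> cases t' <;> exact h.symm

theorem SignedTile.rotate {x y y' x' : C.Edge × Bool} (h : C.SignedTile x y y' x') :
    C.SignedTile (x.1, !x.2) y' y (x'.1, !x'.2) := by
  obtain ⟨x, s⟩ := x
  obtain ⟨y, t⟩ := y
  obtain ⟨x', s'⟩ := x'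
  obtain ⟨y', t'⟩ := y'
  obtain ⟨h₁, h₂, h⟩ := h
  dsimp only at h₁ h₂ h
  subst h₁ h₂
  refine ⟨rfl, rfl, ?_⟩
  cases s' <;> cases t' <;> exact h

theorem SignedTile.unique (hC : C.AtMostOneSquareClosing) {x y y₁ x₁ y₂ x₂ : C.Edge × Bool}
    (h : C.SignedTile x y y₁ x₁) (h' : C.SignedTile x y y₂ x₂) : y₁ = y₂ ∧ x₁ = x₂ := by
  obtain ⟨x, s⟩ := x
  obtain ⟨y, t⟩ := y
  obtain ⟨x₁, s₁⟩ := x₁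
  obtain ⟨y₁, t₁⟩ := y₁
  obtain ⟨x₂, s₂⟩ := x₂
  obtain ⟨y₂, t₂⟩ := y₂
  obtain ⟨h₁, h₂, h⟩ := h
  obtain ⟨h₁', h₂', h'⟩ := h'
  dsimp only at h₁ h₂ h h₁' h₂' h'
  subst h₁ h₂ h₁' h₂'
  suffices y₁ = y₂ ∧ x₁ = x₂ by simpa using this
  cases s₂ <;> cases t₂ <;> dsimp only [cond_true, cond_false] at h h'
  · exact (hC.right _ _ _ _ _ _ h h').symm
  · exact hC.bottom _ _ _ _ _ _ h h'
  · exact (hC.top _ _ _ _ _ _ h h').symm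
  · exact hC.left _ _ _ _ _ _ h h'

theorem SignedTile.cancel (hC : C.BottomEqIffTopEq) {x y' x' : C.Edge × Bool}
    (h : C.SignedTile x (x.1, !x.2) y' x') : x' = (y'.1, !y'.2) := by
  obtain ⟨x, s⟩ := x
  obtain ⟨x', s'⟩ := x'
  obtain ⟨y', t'⟩ := y'
  obtain ⟨h₁, h₂, h⟩ := h
  dsimp only at h₁ h₂ h
  subst h₁ h₂
  suffices x' = y' by simpa using this
  cases s' <;> dsimp only [cond_true, cond_false, Bool.not_true, Bool.not_false] at h
  · exact ((hC _ _ _ _ h).1 rfl).symm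
  · exact (hC _ _ _ _ h).2 rfl

/-- The three given squares form a half cube, with directions `x`, `y`, `z`; the other three
squares of the cube are the ones sought. -/
theorem SignedTile.braid (hC : C.CubeProperty) {x y z z₁ y₁ z₂ x₁ y₂ x₂ : C.Edge × Bool}
    (h₀ : C.SignedTile y z z₁ y₁) (h₁ : C.SignedTile x z₁ z₂ x₁) (h₂ : C.SignedTile x₁ y₁ y₂ x₂) :
    ∃ y' x' z', C.SignedTile x y y' x' ∧ C.SignedTile x' z z' x₂ ∧ C.SignedTile y' z' z₂ y₂ := by
  obtain ⟨x, s⟩ := x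
  obtain ⟨y, t⟩ := y
  obtain ⟨z, r⟩ := z
  obtain ⟨x₁, s₁⟩ := x₁
  obtain ⟨y₁, t₁⟩ := y₁
  obtain ⟨z₁, r₁⟩ := z₁
  obtain ⟨x₂, s₂⟩ := x₂
  obtain ⟨y₂, t₂⟩ := y₂
  obtain ⟨z₂, r₂⟩ := z₂
  obtain ⟨e₁, e₂, h₀⟩ := h₀
  obtain ⟨e₃, e₄, h₁⟩ := h₁
  obtain ⟨e₅, e₆, h₂⟩ := h₂
  dsimp only at e₁ e₂ e₃ e₄ e₅ e₆ h₀ h₁ h₂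
  subst e₁ e₂ e₃ e₄ e₅ e₆
  -- the path `x · y · z` starts at the vertex of the cube with coordinates `!s₂`, `!t₂`, `!r₂`
  let e : C.CubeEdges :=
    { e₀ := fun p q => if q = r₂ then (if p = t₂ then x₂ else x₁) else x
      e₁ := fun p q => if p = s₂ then (if q = r₂ then y₁ else y) else y₂
      e₂ := fun p q => if p = s₂ then (if q = t₂ then z else z₁) else z₂ }
  have he : e.IsHalfCube s₂ (!t₂) r₂ := by
    cases s₂ <;> cases t₂ <;> cases r₂ <;> exact ⟨h₀, h₁, h₂⟩
  obtain ⟨e', hf, g₀, g₁, g₂⟩ := hC _ _ _ e he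
  have hx : e'.e₀ (!t₂) (!r₂) = x := by
    rw [← g₀ _ _ (.inl rfl)]; simp [e]
  have hx₂ : e'.e₀ t₂ r₂ = x₂ := by
    rw [← g₀ _ _ (.inr rfl)]; simp [e]
  have hy : e'.e₁ s₂ (!r₂) = y := by
    rw [← g₁ _ _ (.inl rfl)]; simp [e]
  have hy₂ : e'.e₁ (!s₂) r₂ = y₂ := by
    rw [← g₁ _ _ (.inr rfl)]; simp [e]
  have hz : e'.e₂ s₂ t₂ = z := by
    rw [← g₂ _ _ (.inl rfl)]; simp [e]
  have hz₂ : e'.e₂ (!s₂) (!t₂) = z₂ := by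
    rw [← g₂ _ _ (.inr rfl)]; simp [e]
  have f₀ := (hf (!s₂)).1
  have f₁ := (hf t₂).2.1
  have f₂ := (hf (!r₂)).2.2
  subst hx hx₂ hy hy₂ hz hz₂
  refine ⟨(e'.e₁ (!s₂) (!r₂), t₂), (e'.e₀ t₂ (!r₂), s₂), (e'.e₂ (!s₂) t₂, r₂),
    ⟨rfl, rfl, ?_⟩, ⟨rfl, rfl, ?_⟩, ⟨rfl, rfl, ?_⟩⟩ <;>
  · clear he
    cases s₂ <;> cases t₂ <;> cases r₂ <;> assumption

/-- The swap system of signed edges of `C`. -/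
def signedSwapSystem (hSquare : C.AtMostOneSquareClosing) (hCube : C.CubeProperty)
    (hEq : C.BottomEqIffTopEq) : SwapSystem (C.Edge × Bool) where
  inv x := (x.1, !x.2)
  swap := C.SignedTile
  inv_inv x := by simp
  symm := SignedTile.symm
  rotate := SignedTile.rotate
  unique := SignedTile.unique hSquare
  cancel := SignedTile.cancel hEq
  braid := SignedTile.braid hCube

/-! ### Words of paths -/

/-- The signed edge underlying an arrow of the non-directed graph. -/
def letter {x y : C.UVertex} : (x ⟶ y) → C.Edge × Bool :=
  Sum.elim (fun a => (a.1, true)) (fun a => (a.1, false))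

/-- The word of a non-directed path, last letter first. -/
def word {x : C.UVertex} : ∀ {y : C.UVertex}, Quiver.Path x y → List (C.Edge × Bool)
  | _, .nil => []
  | _, .cons p e => letter e :: word p

theorem word_comp {x y z : C.UVertex} (p : Quiver.Path x y) (q : Quiver.Path y z) :
    word (p.comp q) = word q ++ word p := by
  induction q with
  | nil => rfl
  | cons q e ih => simp [word, ih]

theorem PathTile.exists_signedTile {x y : C.UVertex} {p q : Quiver.Path x y}
    (h : PathTile p q) :
    ∃ a b b' a', C.SignedTile a b b' a' ∧ word p = [b, a] ∧ word q = [a', b'] := by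
  induction h with
  | pos_pos a b b' a' h =>
    exact ⟨(a.1, true), (b.1, true), (b'.1, true), (a'.1, true), ⟨rfl, rfl, h⟩, rfl, rfl⟩
  | neg_neg a b b' a' h =>
    exact ⟨(b.1, false), (a.1, false), (a'.1, false), (b'.1, false), ⟨rfl, rfl, h.symm⟩, rfl, rfl⟩
  | neg_pos a b b' a' h =>
    exact ⟨(a.1, false), (b'.1, true), (b.1, true), (a'.1, false), ⟨rfl, rfl, h⟩, rfl, rfl⟩
  | neg_pos' a b b' a' h =>
    exact ⟨(b'.1, false), (a.1, true), (a'.1, true), (b.1, false), ⟨rfl, rfl, h.symm⟩, rfl, rfl⟩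
  | symm _ ih =>
    obtain ⟨a, b, b', a', h, hp, hq⟩ := ih
    exact ⟨b', a', a, b, h.symm, hq, hp⟩

section Action

variable (hSquare : C.AtMostOneSquareClosing) (hCube : C.CubeProperty) (hEq : C.BottomEqIffTopEq)

local notation "Δ" => signedSwapSystem hSquare hCube hEq

theorem Dihomotopic.eqv_actWord {x y : C.UVertex} {p q : Quiver.Path x y} (h : Dihomotopic p q)
    {n : List (C.Edge × Bool)} (hn : (Δ).Reduced n) :
    (Δ).Eqv ((Δ).actWord (word p) n) ((Δ).actWord (word q) n) := by
  induction h generalizing n with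
  | tile h =>
    obtain ⟨a, b, b', a', h, hp, hq⟩ := h.exists_signedTile
    rw [hp, hq]
    exact SwapSystem.act_swap (D := Δ) h hn
  | refl p => exact .refl _
  | symm _ ih => exact (ih hn).symm
  | trans _ _ ih₁ ih₂ => exact (ih₁ hn).trans (ih₂ hn)
  | comp _ _ ih₁ ih₂ =>
    rw [word_comp, word_comp, SwapSystem.actWord_append, SwapSystem.actWord_append]
    exact (SwapSystem.actWord_congr _ (ih₁ hn)).trans (ih₂ (hn.actWord _))

/-- The action of a path on reduced words depends only on its homotopy class. -/
theorem Homotopic.eqv_actWord {x y : C.UVertex} {p q : Quiver.Path x y} (h : Homotopic p q)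
    {n : List (C.Edge × Bool)} (hn : (Δ).Reduced n) :
    (Δ).Eqv ((Δ).actWord (word p) n) ((Δ).actWord (word q) n) := by
  induction h generalizing n with
  | dihom h => exact h.eqv_actWord hSquare hCube hEq hn
  | pos_neg a => exact SwapSystem.act_inv_act (D := Δ) (a.1, true) hn
  | neg_pos a => exact SwapSystem.act_inv_act (D := Δ) (a.1, false) hn
  | symm _ ih => exact (ih hn).symm
  | trans _ _ ih₁ ih₂ => exact (ih₁ hn).trans (ih₂ hn)
  | comp _ _ ih₁ ih₂ =>
    rw [word_comp, word_comp, SwapSystem.actWord_append, SwapSystem.actWord_append]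
    exact (SwapSystem.actWord_congr _ (ih₁ hn)).trans (ih₂ (hn.actWord _))

theorem forall_mem_snd_of_step {w w' : List (C.Edge × Bool)} (h : (Δ).Step w w')
    (hw : ∀ l ∈ w, l.2 = true) : ∀ l ∈ w', l.2 = true := by
  induction h with
  | swap q h =>
    simp only [List.forall_mem_cons] at hw ⊢
    exact ⟨h.1.trans hw.2.1, h.2.1.trans hw.1, hw.2.2⟩
  | cons a _ ih =>
    simp only [List.forall_mem_cons] at hw ⊢
    exact ⟨hw.1, ih hw.2⟩

theorem reduced_of_forall_mem_snd {w : List (C.Edge × Bool)} (hw : ∀ l ∈ w, l.2 = true) :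
    (Δ).Reduced w := by
  intro c u v h
  have hpos : ∀ {w'}, (Δ).Eqv w w' → ∀ l ∈ w', l.2 = true := fun h => by
    induction h with
    | refl => exact hw
    | tail _ h ih => exact forall_mem_snd_of_step hSquare hCube hEq h ih
  have h₁ := hpos h c (by simp)
  have h₂ : (!c.2) = true := hpos h ((Δ).inv c) (by simp)
  simp [h₁] at h₂

/-! ### Lifting equivalences of words to dihomotopies -/

theorem forall_mem_word_toUPath {x y : C.Vertex} (f : Quiver.Path x y) :
    ∀ l ∈ word (toUPath f), l.2 = true := by
  induction f with
  | nil => intro l hl; cases hl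
  | cons f e ih =>
    change ∀ l ∈ (e.1, true) :: word (toUPath f), l.2 = true
    exact List.forall_mem_cons.2 ⟨rfl, ih⟩

theorem word_toUPath_injective {x y : C.Vertex} {f g : Quiver.Path x y}
    (h : word (toUPath f) = word (toUPath g)) : f = g := by
  induction f with
  | nil =>
    cases g with
    | nil => rfl
    | cons g e => cases h
  | cons f e ih =>
    cases g with
    | nil => cases h
    | cons g e' =>
      change (e.1, true) :: word (toUPath f) = (e'.1, true) :: word (toUPath g) at h
      obtain ⟨h₁, h₂⟩ := List.cons.inj h
      obtain ⟨a, rfl, rfl⟩ := e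
      obtain ⟨a', rfl, ha'⟩ := e'
      obtain rfl : a = a' := congrArg Prod.fst h₁
      rw [ih h₂]

theorem toUPath_cons {x y z : C.Vertex} (f : Quiver.Path x y) (e : y ⟶ z) :
    toUPath (f.cons e) = (toUPath f).comp (pos e) := rfl

theorem exists_dihomotopic_of_step {x y : C.Vertex} (f : Quiver.Path x y)
    {w : List (C.Edge × Bool)} (h : (Δ).Step (word (toUPath f)) w) :
    ∃ g : Quiver.Path x y, word (toUPath g) = w ∧ Dihomotopic (toUPath f) (toUPath g) := by
  generalize hw : word (toUPath f) = w₀ at h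
  induction h generalizing y with
  | @swap a b b' a' q h =>
    cases f with
    | nil => cases hw
    | cons f eb =>
      cases f with
      | nil => cases hw
      | cons f ea =>
        change (eb.1, true) :: (ea.1, true) :: word (toUPath f) = _ at hw
        simp only [List.cons.injEq] at hw
        obtain ⟨rfl, rfl, rfl⟩ := hw
        obtain ⟨b', t⟩ := b'
        obtain ⟨a', s⟩ := a'
        obtain ⟨h₁, h₂, h⟩ := h
        dsimp only at h₁ h₂ h
        subst h₁ h₂
        dsimp only [cond_true] at h
        -- a square determines the end points of its edges
        have hface : C.edgeFace false b' = C.edgeFace false ea.1 ∧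
            C.edgeFace true b' = C.edgeFace false a' ∧
            C.edgeFace true a' = C.edgeFace true eb.1 := by
          obtain ⟨α, ⟨h₁, h₂, h₃, h₄⟩ | ⟨h₁, h₂, h₃, h₄⟩⟩ := h <;>
          rw [h₁, h₂, h₃, h₄] <;> simp [C.face_face]
        let eb' : _ ⟶ C.edgeFace true b' := ⟨b', hface.1.trans ea.2.1, rfl⟩
        let ea' : C.edgeFace true b' ⟶ _ := ⟨a', hface.2.1.symm, hface.2.2.trans eb.2.2⟩
        refine ⟨(f.cons eb').cons ea', rfl, ?_⟩
        exact .comp (.refl (toUPath f)) (.tile (.pos_pos ea eb eb' ea' h))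
  | cons a _ ih =>
    cases f with
    | nil => cases hw
    | cons f e =>
      change (e.1, true) :: word (toUPath f) = _ at hw
      simp only [List.cons.injEq] at hw
      obtain ⟨rfl, hw⟩ := hw
      obtain ⟨g, hg, hfg⟩ := ih f hw
      refine ⟨g.cons e, ?_, ?_⟩
      · rw [← hg]; rfl
      · rw [toUPath_cons, toUPath_cons]
        exact hfg.comp (.refl _)

/-- Dipaths with equivalent words are dihomotopic. -/
theorem dihomotopic_of_eqv {x y : C.Vertex} {f g : Quiver.Path x y}
    (h : (Δ).Eqv (word (toUPath f)) (word (toUPath g))) :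
    Dihomotopic (toUPath f) (toUPath g) := by
  suffices ∀ w, (Δ).Eqv (word (toUPath f)) w →
      ∃ g : Quiver.Path x y, word (toUPath g) = w ∧ Dihomotopic (toUPath f) (toUPath g) by
    obtain ⟨g', hg', hd⟩ := this _ h
    rwa [word_toUPath_injective hg'] at hd
  intro w h
  induction h with
  | refl => exact ⟨f, rfl, .refl _⟩
  | tail _ hs ih =>
    obtain ⟨g, rfl, hd⟩ := ih
    obtain ⟨g', hg', hd'⟩ := exists_dihomotopic_of_step hSquare hCube hEq g hs
    exact ⟨g', hg', hd.trans hd'⟩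

end Action

end TwoPrecubicalSet

theorem mainTheorem1 (C : TwoPrecubicalSet.{u, v, w})
    (hSquare : C.AtMostOneSquareClosing) (hCube : C.CubeProperty)
    (hEq : C.BottomEqIffTopEq)
    {x y : C.Vertex} (f g : Quiver.Path x y) :
    TwoPrecubicalSet.Homotopic (TwoPrecubicalSet.toUPath f) (TwoPrecubicalSet.toUPath g) ↔
      TwoPrecubicalSet.Dihomotopic (TwoPrecubicalSet.toUPath f) (TwoPrecubicalSet.toUPath g) := by
  refine ⟨fun h => ?_, .dihom⟩
  have hred {x y : C.Vertex} (f : Quiver.Path x y) :=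
    TwoPrecubicalSet.reduced_of_forall_mem_snd hSquare hCube hEq
      (TwoPrecubicalSet.forall_mem_word_toUPath f)
  have hnil := hred (Quiver.Path.nil (a := x))
  exact TwoPrecubicalSet.dihomotopic_of_eqv hSquare hCube hEq
    ((hred f).actWord_nil.symm.trans
      ((h.eqv_actWord hSquare hCube hEq hnil).trans (hred g).actWord_nil))
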